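/- Let $(X,\mathcal B)$ be a standard Borel space and $\mu$ a $\sigma$-finite measure on it with $\mu(\{x\})=0$ for every $x\in X$ and $\mu(X)=\infty$. Let $X^*$ be the set of countable subsets of $X$, with the $\sigma$-algebra $\mathcal B^*$ generated by the sets $\{\omega\in X^*: |\omega\cap B|=n\}$ ($B\in\mathcal B$, $n\ge 0$), and let $\mu^*$ be the law on $(X^*,\mathcal B^*)$ of the Poisson point process with intensity $\mu$, i.e. the probability measure under which, for pairwise disjoint $A_1,\dots,A_n\in\mathcal B$, the variables $|\omega\cap A_i|$ are jointly independent and Poisson distributed with mean $\mu(A_i)$ (almost surely infinite if $\mu(A_i)=\infty$). Let a group $G$ act on $X$ by measurable, $\mu$-preserving transformations $T_g$, $g\in G$, and let $T\times T_*$ be the action of $G$ on $(X\times X^*,\mu\times\mu^*)$ given by $(x,\omega)\mapsto (T_gx,\{T_gy: y\in\omega\})$. Assume that $T\times T_*$ is ergodic: every measurable set $A\subseteq X\times X^*$ that is, for each $g\in G$, invariant under $g$ up to a $\mu\times\mu^*$-null set is null or has null complement. Let $\Phi\colon X\to L^1(\mu)$, $x\mapsto\Phi_x$ (real or complex $L^1$),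 be Borel measurable and $T$-equivariant: for every $g\in G$ and $\mu$-almost every $x\in X$, $\Phi_{T_gx}\circ T_g=\Phi_x$ in $L^1(\mu)$. Then $\Phi_x=0$ for $\mu$-almost every $x\in X$. -/

import Mathlib

open MeasureTheory ProbabilityTheory

/-- The space of countable subsets of `X`, on which the Poisson point process lives. -/
@[ext]
structure CountableSubset (X : Type*) where
  /-- The set of points. -/
  carrier : Set X
  countable : carrier.Countable

namespace CountableSubset

/-- The number `|ω ∩ B|` of points of `ω` in `B`, possibly infinite. -/
noncomputable def count {X : Type*} (ω : CountableSubset X) (B : Set X) : ℕ∞ :=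
  (ω.carrier ∩ B).encard

/-- The σ-algebra generated by the sets `{ω : |ω ∩ B| = n}`, with `B` measurable and `n : ℕ`. -/
instance instMeasurableSpace {X : Type*} [MeasurableSpace X] :
    MeasurableSpace (CountableSubset X) :=
  MeasurableSpace.generateFrom
    {S | ∃ (B : Set X) (n : ℕ), MeasurableSet B ∧
      S = {ω : CountableSubset X | ω.count B = (n : ℕ∞)}}

/-- The action induced on countable subsets: `g • ω = {g • x : x ∈ ω}`. If `G` acts on `X` by
measure-preserving transformations, this is the Poisson suspension of the action. -/
instance instMulAction {G X : Type*} [Group G] [MulAction G X] :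
    MulAction G (CountableSubset X) where
  smul g ω := ⟨(fun x => g • x) '' ω.carrier, ω.countable.image _⟩
  one_smul ω := CountableSubset.ext (by
    change (fun x => (1 : G) • x) '' ω.carrier = ω.carrier
    simp)
  mul_smul g h ω := CountableSubset.ext (by
    change (fun x => (g * h) • x) '' ω.carrier = (fun x => g • x) '' ((fun x => h • x) '' ω.carrier)
    simp [Set.image_image, mul_smul])

end CountableSubset

/-- `P` is the law of the Poisson point process with intensity `μ`: a probability measure on the
countable subsets of `X` under which the numbers of points in pairwise disjoint measurable sets
are jointly independent, the number of points in `A` being Poisson with mean `μ A`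
(and almost surely infinite if `μ A = ∞`). -/
structure IsPoissonPointProcess {X : Type*} [MeasurableSpace X] (μ : Measure X)
    (P : Measure (CountableSubset X)) : Prop where
  isProbabilityMeasure : IsProbabilityMeasure P
  measure_count_eq : ∀ A : Set X, MeasurableSet A → μ A ≠ ⊤ → ∀ k : ℕ,
    P {ω | ω.count A = (k : ℕ∞)} =
      ENNReal.ofReal (Real.exp (-(μ A).toReal) * (μ A).toReal ^ k / (k.factorial : ℝ))
  measure_count_eq_top : ∀ A : Set X, MeasurableSet A → μ A = ⊤ → P {ω | ω.count A = ⊤} = 1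
  iIndepFun_count : ∀ (n : ℕ) (A : Fin n → Set X), (∀ i, MeasurableSet (A i)) →
    Pairwise (fun i j => Disjoint (A i) (A j)) →
    iIndepFun (fun (i : Fin n) (ω : CountableSubset X) => ω.count (A i)) P

open Filter Topology
open scoped ENNReal

/-! ### Measurability on configuration space. -/

section CountableSubset

variable {X : Type*}

/-! Let `A` be a level set `{(x, y) : |Φ_x(y)| ≥ 1/(n+1)}`. Its sections `A_x` have finite measure
by Markov, and equivariance makes `A` invariant under the diagonal action up to null sets. So `{(x,
ω) : ω ∩ A_x = ∅}` is almost invariant, hence null or conull. Its slice at `x` has probability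
`exp(-μ(A_x)) > 0`, which rules out null; conull forces `μ(A_x) = 0` for almost every `x`
(`ae_measure_section_eq_zero`). Letting `n` vary gives `Φ_x = 0`. The technical inputs are
measurability of the avoiding set (`measurableSet_avoidingSet`) and of `(x, y) ↦ |Φ_x(y)|`
(`exists_measurable_enorm_version`). -/

theorem CountableSubset.count_eq_zero {ω : CountableSubset X} {B : Set X} :
    ω.count B = 0 ↔ ∀ y ∈ ω.carrier, y ∉ B := by
  rw [CountableSubset.count, Set.encard_eq_zero, ← Set.disjoint_iff_inter_eq_empty,
    Set.disjoint_left]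

theorem CountableSubset.count_smul {G : Type*} [Group G] [MulAction G X] (g : G)
    (ω : CountableSubset X) (B : Set X) :
    (g • ω).count B = ω.count ((fun x => g • x) ⁻¹' B) := by
  change ((fun x => g • x) '' ω.carrier ∩ B).encard = _
  rw [← Set.image_inter_preimage, (MulAction.injective g).encard_image]
  rfl

theorem CountableSubset.setOf_count_ne_top (B : Set X) :
    {ω : CountableSubset X | ω.count B ≠ ⊤} =
      ⋃ n : ℕ, {ω : CountableSubset X | ω.count B = (n : ℕ∞)} := by
  ext ω
  simp [ENat.ne_top_iff_exists, eq_comm]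

variable [MeasurableSpace X]

theorem CountableSubset.measurableSet_count_eq {B : Set X} (hB : MeasurableSet B) (n : ℕ) :
    MeasurableSet {ω : CountableSubset X | ω.count B = (n : ℕ∞)} :=
  MeasurableSpace.measurableSet_generateFrom ⟨B, n, hB, rfl⟩

theorem CountableSubset.measurableSet_count_ne_top {B : Set X} (hB : MeasurableSet B) :
    MeasurableSet {ω : CountableSubset X | ω.count B ≠ ⊤} := by
  rw [CountableSubset.setOf_count_ne_top]
  exact .iUnion fun n => CountableSubset.measurableSet_count_eq hB n

theorem CountableSubset.measurable_count {B : Set X} (hB : MeasurableSet B) :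
    Measurable fun ω : CountableSubset X => ω.count B := by
  refine measurable_to_countable' fun n => ?_
  induction n using ENat.recTopCoe with
  | top =>
    convert (CountableSubset.measurableSet_count_ne_top hB).compl using 1
    ext ω
    simp
  | coe n => exact CountableSubset.measurableSet_count_eq hB n

instance CountableSubset.instMeasurableConstSMul {G : Type*} [Group G] [MulAction G X]
    [MeasurableConstSMul G X] : MeasurableConstSMul G (CountableSubset X) where
  measurable_const_smul g := by
    refine measurable_generateFrom ?_
    rintro _ ⟨B, n, hB, rfl⟩
    simp only [Set.preimage_ofPred_eq, CountableSubset.count_smul]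
    exact CountableSubset.measurableSet_count_eq (measurable_const_smul g hB) n

/-- The counting measure on `ω ∩ E` for `ω` with exactly `k` points in `E`, and `0` otherwise,
as a kernel on configurations `ω`. -/
noncomputable def CountableSubset.countKernel [MeasurableSingletonClass X] {E : Set X}
    (hE : MeasurableSet E) (k : ℕ) : Kernel (CountableSubset X) X where
  toFun ω := ⨆ _ : ω.count E = k, Measure.count.restrict (ω.carrier ∩ E)
  measurable' := by
    classical
    refine Measure.measurable_of_measurable_coe _ fun B hB => ?_
    have h : (fun ω : CountableSubset X =>
        (⨆ _ : ω.count E = k, Measure.count.restrict (ω.carrier ∩ E) : Measure X) B) =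
        fun ω => if ω.count E = (k : ℕ∞) then (ω.count (B ∩ E) : ℝ≥0∞) else 0 := by
      ext ω
      split_ifs with hk
      · rw [iSup_pos hk, Measure.restrict_apply hB, Measure.count_apply
          (hB.inter (ω.countable.measurableSet.inter hE)), CountableSubset.count]
        congr 2
        ext y
        simp only [Set.mem_inter_iff]
        tauto
      · rw [iSup_neg hk]
        rfl
    rw [h]
    exact Measurable.ite (CountableSubset.measurableSet_count_eq hE k)
      ((measurable_of_countable _).comp (CountableSubset.measurable_count (hB.inter hE)))
      measurable_const

theorem CountableSubset.countKernel_apply [MeasurableSingletonClass X] {E B : Set X}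
    (hE : MeasurableSet E) (hB : MeasurableSet B) {k : ℕ} {ω : CountableSubset X}
    (hω : ω.count E = k) :
    CountableSubset.countKernel hE k ω B = (ω.count (B ∩ E) : ℝ≥0∞) := by
  change (⨆ _ : ω.count E = k, Measure.count.restrict (ω.carrier ∩ E) : Measure X) B = _
  rw [iSup_pos hω, Measure.restrict_apply hB, Measure.count_apply
    (hB.inter (ω.countable.measurableSet.inter hE)), CountableSubset.count]
  congr 2
  ext y
  simp only [Set.mem_inter_iff]
  tauto

/-- Fixing the number `k` of points in `E` bounds the total mass uniformly in `ω`. Finiteness of the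
kernel then makes the mass of a section measurable in its parameters. -/
instance CountableSubset.isFiniteKernel_countKernel [MeasurableSingletonClass X] {E : Set X}
    (hE : MeasurableSet E) (k : ℕ) : IsFiniteKernel (CountableSubset.countKernel hE k) where
  exists_univ_le := by
    refine ⟨k, ENNReal.natCast_lt_top k, fun ω => ?_⟩
    by_cases hk : ω.count E = k
    · rw [CountableSubset.countKernel_apply hE .univ hk, Set.univ_inter, hk]
      simp
    · change (⨆ _ : ω.count E = k, Measure.count.restrict (ω.carrier ∩ E) : Measure X) _ ≤ _
      rw [iSup_neg hk]
      exact zero_le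

/-- The pairs `(x, ω)` with `ω` finite on every `E n` and disjoint from the section of `A`
at `x`. -/
def avoidingSet (E : ℕ → Set X) (A : Set (X × X)) : Set (X × CountableSubset X) :=
  {p | (∀ n, p.2.count (E n) ≠ ⊤) ∧ p.2.count (Prod.mk p.1 ⁻¹' A) = 0}

/-- The section of `A` moves with `x`, so the generators of the σ-algebra do not suffice. Splitting
by the finite number of points in each `E n` reduces the claim to vanishing of finite kernels on
sections. -/
theorem measurableSet_avoidingSet [MeasurableSingletonClass X] {E : ℕ → Set X}
    (hE : ∀ n, MeasurableSet (E n)) (hEU : ⋃ n, E n = Set.univ) {A : Set (X × X)}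
    (hA : MeasurableSet A) : MeasurableSet (avoidingSet E A) := by
  have h : avoidingSet E A = ⋂ n, ⋃ k : ℕ,
      {p : X × CountableSubset X | p.2.count (E n) = (k : ℕ∞)} ∩
        {p | CountableSubset.countKernel (hE n) k p.2 (Prod.mk p.1 ⁻¹' A) = 0} := by
    ext ⟨x, ω⟩
    have key : ∀ n (k : ℕ), ω.count (E n) = k →
        (CountableSubset.countKernel (hE n) k ω (Prod.mk x ⁻¹' A) = 0 ↔
          ω.count (Prod.mk x ⁻¹' A ∩ E n) = 0) := fun n k hk => by
      rw [CountableSubset.countKernel_apply (hE n) (measurable_prodMk_left hA) hk]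
      simp
    simp only [avoidingSet, Set.mem_ofPred_eq, Set.mem_iInter, Set.mem_iUnion, Set.mem_inter_iff]
    constructor
    · rintro ⟨h1, h2⟩ n
      obtain ⟨k, hk⟩ := ENat.ne_top_iff_exists.1 (h1 n)
      refine ⟨k, hk.symm, (key n k hk.symm).2 ?_⟩
      rw [CountableSubset.count_eq_zero] at h2 ⊢
      exact fun y hy hyA => h2 y hy hyA.1
    · intro h
      refine ⟨fun n => ?_, ?_⟩
      · obtain ⟨k, hk, -⟩ := h n
        simp [hk]
      · rw [CountableSubset.count_eq_zero]
        intro y hy hyA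
        obtain ⟨n, hn⟩ := Set.mem_iUnion.1 (hEU.ge (Set.mem_univ y))
        obtain ⟨k, hk, hk'⟩ := h n
        exact CountableSubset.count_eq_zero.1 ((key n k hk).1 hk') y hy ⟨hyA, hn⟩
  rw [h]
  refine .iInter fun n => .iUnion fun k => .inter ?_ ?_
  · exact measurable_snd (CountableSubset.measurableSet_count_eq (hE n) k)
  · have : Measurable fun p : X × CountableSubset X =>
        CountableSubset.countKernel (hE n) k p.2 (Prod.mk p.1 ⁻¹' A) := by
      have h2 := Kernel.measurable_kernel_prodMk_left
        (κ := (CountableSubset.countKernel (hE n) k).comap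
          (Prod.snd : X × CountableSubset X → _) measurable_snd)
        (t := (fun q : (X × CountableSubset X) × X => (q.1.1, q.2)) ⁻¹' A)
        ((measurable_fst.fst.prodMk measurable_snd) hA)
      exact h2
    exact this (measurableSet_singleton 0)

end CountableSubset

/-! ### Almost sure properties of the Poisson process. -/

namespace IsPoissonPointProcess

variable {X : Type*} [MeasurableSpace X] {μ : Measure X} {P : Measure (CountableSubset X)}

theorem measure_count_eq_zero (hP : IsPoissonPointProcess μ P) {A : Set X}
    (hA : MeasurableSet A) (hμA : μ A ≠ ⊤) :
    P {ω | ω.count A = 0} = ENNReal.ofReal (Real.exp (-(μ A).toReal)) := by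
  simpa using hP.measure_count_eq A hA hμA 0

theorem ae_count_eq_zero (hP : IsPoissonPointProcess μ P) {A : Set X} (hA : MeasurableSet A)
    (hμA : μ A = 0) : ∀ᵐ ω ∂P, ω.count A = 0 := by
  have := hP.isProbabilityMeasure
  have h := hP.measure_count_eq_zero hA (by simp [hμA])
  rw [hμA, ENNReal.toReal_zero, neg_zero, Real.exp_zero, ENNReal.ofReal_one] at h
  exact (mem_ae_iff_prob_eq_one (CountableSubset.measurableSet_count_eq hA 0)).2 h

theorem ae_count_ne_top (hP : IsPoissonPointProcess μ P) {A : Set X} (hA : MeasurableSet A)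
    (hμA : μ A ≠ ⊤) : ∀ᵐ ω ∂P, ω.count A ≠ ⊤ := by
  have := hP.isProbabilityMeasure
  -- The Poisson weights of finite counts already sum to 1.
  have hsum : HasSum (fun k : ℕ => Real.exp (-(μ A).toReal) * (μ A).toReal ^ k / k.factorial) 1 := by
    have h := (NormedSpace.expSeries_div_hasSum_exp ((μ A).toReal)).mul_left
      (Real.exp (-(μ A).toReal))
    rw [← Real.exp_eq_exp_ℝ, ← Real.exp_add, neg_add_cancel, Real.exp_zero] at h
    simpa only [mul_div_assoc] using h
  refine (mem_ae_iff_prob_eq_one (CountableSubset.measurableSet_count_ne_top hA)).2 ?_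
  rw [CountableSubset.setOf_count_ne_top, measure_iUnion ?_
    fun k => CountableSubset.measurableSet_count_eq hA k, tsum_congr (hP.measure_count_eq A hA hμA),
    ← ENNReal.ofReal_tsum_of_nonneg (fun k => by positivity) hsum.summable, hsum.tsum_eq,
    ENNReal.ofReal_one]
  intro i j hij
  refine Set.disjoint_left.2 fun ω hi hj => hij ?_
  exact ENat.natCast_inj.1 (Eq.trans (Eq.symm hi) hj)

end IsPoissonPointProcess

/-- A measurable map into `L¹` admits a jointly measurable version of its pointwise norm. -/
theorem exists_measurable_enorm_version {𝕜 : Type*} [RCLike 𝕜] {X Y : Type*} [MeasurableSpace X]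
    [MeasurableSpace Y] {μ : Measure X}
    [TopologicalSpace.SeparableSpace (Lp 𝕜 1 μ)] {Φ : Y → Lp 𝕜 1 μ}
    (hΦ : Measurable[_, borel (Lp 𝕜 1 μ)] Φ) :
    ∃ f : Y × X → ℝ≥0∞, Measurable f ∧ ∀ x, (fun y => f (x, y)) =ᵐ[μ] fun y => ‖Φ x y‖ₑ := by
  classical
  let d := TopologicalSpace.denseSeq (Lp 𝕜 1 μ)
  -- Choosing the least such `k` makes the approximant depend measurably on `x`. The rate `2⁻ⁿ` is
  -- summable, so the approximants converge almost everywhere and not only in `L¹`.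
  have hd : ∀ (n : ℕ) (x : Y), ∃ k, ‖Φ x - d k‖ < (1 / 2 : ℝ) ^ n := fun n x => by
    obtain ⟨k, hk⟩ := (TopologicalSpace.denseRange_denseSeq (Lp 𝕜 1 μ)).exists_dist_lt (Φ x)
      (show (0 : ℝ) < (1 / 2) ^ n by positivity)
    exact ⟨k, by rwa [← dist_eq_norm]⟩
  have hm : ∀ n, Measurable fun x => Nat.find (hd n x) := fun n =>
    measurable_find (hd n) fun k => by
      have ho : IsOpen {z : Lp 𝕜 1 μ | ‖z - d k‖ < (1 / 2 : ℝ) ^ n} :=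
        isOpen_lt (by fun_prop) continuous_const
      exact hΦ (MeasurableSpace.measurableSet_generateFrom ho)
  let u : ℕ → Y × X → 𝕜 := fun n p => d (Nat.find (hd n p.1)) p.2
  have hu : ∀ n, Measurable (u n) := fun n => by
    have h : Measurable fun q : ℕ × X => (d q.1 : X → 𝕜) q.2 :=
      measurable_from_prod_countable_right fun k => (Lp.stronglyMeasurable (d k)).measurable
    exact h.comp (((hm n).comp measurable_fst).prodMk measurable_snd)
  -- The limsup is measurable everywhere and is the limit wherever that exists.
  refine ⟨fun p => limsup (fun n => ‖u n p‖ₑ) atTop, .limsup fun n => (hu n).enorm, fun x => ?_⟩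
  have hbound : ∀ n, ∫⁻ y, ‖u n (x, y) - Φ x y‖ₑ ∂μ ≤ ENNReal.ofReal ((1 / 2 : ℝ) ^ n) := fun n => by
    have h1 : ∫⁻ y, ‖u n (x, y) - Φ x y‖ₑ ∂μ = ‖Φ x - d (Nat.find (hd n x))‖ₑ := by
      rw [Lp.enorm_def, eLpNorm_one_eq_lintegral_enorm]
      refine lintegral_congr_ae ?_
      filter_upwards [Lp.coeFn_sub (Φ x) (d (Nat.find (hd n x)))] with y hy
      rw [hy, Pi.sub_apply, enorm_sub_rev]
    rw [h1, ← ofReal_norm]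
    exact ENNReal.ofReal_le_ofReal (Nat.find_spec (hd n x)).le
  have hmeas : ∀ n, Measurable fun y => ‖u n (x, y) - Φ x y‖ₑ := fun n =>
    (((hu n).comp measurable_prodMk_left).sub (Lp.stronglyMeasurable (Φ x)).measurable).enorm
  have htsum : ∫⁻ y, ∑' n, ‖u n (x, y) - Φ x y‖ₑ ∂μ ≠ ⊤ := by
    rw [lintegral_tsum fun n => (hmeas n).aemeasurable]
    refine ne_top_of_le_ne_top ?_ (ENNReal.tsum_le_tsum hbound)
    rw [← ENNReal.ofReal_tsum_of_nonneg (fun n => by positivity) summable_geometric_two]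
    exact ENNReal.ofReal_ne_top
  filter_upwards [ae_lt_top (Measurable.tsum hmeas) htsum] with y hy
  have h0 := ENNReal.tendsto_atTop_zero_of_tsum_ne_top hy.ne
  have h1 : Tendsto (fun n => u n (x, y)) atTop (𝓝 (Φ x y)) := by
    rw [tendsto_iff_edist_tendsto_0]
    simpa only [edist_eq_enorm_sub] using h0
  exact h1.enorm.limsup_eq

/-! ### Ergodicity applied to the avoiding set. -/

section Ergodic

variable {X : Type*} [MeasurableSpace X] [MeasurableSingletonClass X] {μ : Measure X} [SigmaFinite μ]
  {G : Type*} [Group G] [MulAction G X] [MeasurableConstSMul G X] [SMulInvariantMeasure G X μ]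
  {P : Measure (CountableSubset X)}

/-- For almost every `x`, the points `y` where invariance of `A` fails form a null set, which almost
every `ω` misses. The finiteness conditions hold almost surely both before and after moving `ω`. -/
theorem preimage_smul_avoidingSet_ae_eq (hP : IsPoissonPointProcess μ P) {A : Set (X × X)}
    (hA : MeasurableSet A) (g : G)
    (hinv : ∀ᵐ x ∂μ, ∀ᵐ y ∂μ, (g • x, g • y) ∈ A ↔ (x, y) ∈ A) :
    (g • · : X × CountableSubset X → _) ⁻¹' avoidingSet (spanningSets μ) A
      =ᵐ[μ.prod P] avoidingSet (spanningSets μ) A := by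
  have := hP.isProbabilityMeasure
  have hS := measurableSet_avoidingSet (measurableSet_spanningSets μ) (iUnion_spanningSets μ) hA
  have hg : Measurable (g • · : X × CountableSubset X → _) :=
    (measurable_fst.const_smul g).prodMk (measurable_snd.const_smul g)
  have hset : MeasurableSet {p : X × CountableSubset X |
      (g • p ∈ avoidingSet (spanningSets μ) A) = (p ∈ avoidingSet (spanningSets μ) A)} := by
    simp only [eq_iff_iff]
    exact MeasurableSet.iff (hg hS) hS
  refine (Measure.ae_prod_iff_ae_ae hset).2 ?_
  filter_upwards [hinv] with x hx
  set D : Set X := {y | ¬ ((g • x, g • y) ∈ A ↔ (x, y) ∈ A)}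
  have hD : MeasurableSet D := by
    refine (MeasurableSet.iff ?_ ?_).compl
    · exact ((measurable_const (a := g • x)).prodMk (measurable_const_smul g)) hA
    · exact measurable_prodMk_left hA
  have h1 : ∀ᵐ ω ∂P, ∀ n, ω.count (spanningSets μ n) ≠ ⊤ := ae_all_iff.2 fun n =>
    hP.ae_count_ne_top (measurableSet_spanningSets μ n) (measure_spanningSets_lt_top μ n).ne
  have h2 : ∀ᵐ ω ∂P, ∀ n, ω.count ((fun x => g • x) ⁻¹' spanningSets μ n) ≠ ⊤ :=
    ae_all_iff.2 fun n => hP.ae_count_ne_top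
      (measurable_const_smul g (measurableSet_spanningSets μ n)) (by
        rw [measure_preimage_smul]
        exact (measure_spanningSets_lt_top μ n).ne)
  filter_upwards [h1, h2, hP.ae_count_eq_zero hD hx] with ω h1 h2 h3
  rw [CountableSubset.count_eq_zero] at h3
  refine propext (and_congr ?_ ?_)
  · simp only [Prod.smul_snd, CountableSubset.count_smul]
    exact iff_of_true h2 h1
  rw [Prod.smul_snd, CountableSubset.count_smul, CountableSubset.count_eq_zero,
    CountableSubset.count_eq_zero]
  refine forall₂_congr fun y hy => not_congr ?_
  exact not_not.1 (h3 y hy)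

theorem ae_measure_section_eq_zero (hμ : μ ≠ 0) (hP : IsPoissonPointProcess μ P)
    [ErgodicSMul G (X × CountableSubset X) (μ.prod P)] {A : Set (X × X)}
    (hA : MeasurableSet A) (hfin : ∀ x, μ (Prod.mk x ⁻¹' A) ≠ ⊤)
    (hinv : ∀ g : G, ∀ᵐ x ∂μ, ∀ᵐ y ∂μ, (g • x, g • y) ∈ A ↔ (x, y) ∈ A) :
    ∀ᵐ x ∂μ, μ (Prod.mk x ⁻¹' A) = 0 := by
  have := hP.isProbabilityMeasure
  have hS := measurableSet_avoidingSet (measurableSet_spanningSets μ) (iUnion_spanningSets μ) hA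
  have hslice : ∀ x, ∀ᵐ ω ∂P, ((x, ω) ∈ avoidingSet (spanningSets μ) A ↔
      ω.count (Prod.mk x ⁻¹' A) = 0) := fun x => by
    have h1 : ∀ᵐ ω ∂P, ∀ n, ω.count (spanningSets μ n) ≠ ⊤ := ae_all_iff.2 fun n =>
      hP.ae_count_ne_top (measurableSet_spanningSets μ n) (measure_spanningSets_lt_top μ n).ne
    filter_upwards [h1] with ω h1
    exact and_iff_right h1
  have hval := fun x => hP.measure_count_eq_zero (measurable_prodMk_left hA) (hfin x)
  rcases eventuallyConst_set.1 (ErgodicSMul.aeconst_of_forall_preimage_smul_ae_eq hS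
    fun g : G => preimage_smul_avoidingSet_ae_eq hP hA g (hinv g)) with h | h
  · filter_upwards [Measure.ae_ae_of_ae_prod h] with x hx
    have h1 : P {ω | ω.count (Prod.mk x ⁻¹' A) = 0} = 1 := by
      refine (mem_ae_iff_prob_eq_one
        (CountableSubset.measurableSet_count_eq (measurable_prodMk_left hA) 0)).1 ?_
      filter_upwards [hx, hslice x] with ω h1 h2 using h2.1 h1
    rw [hval x, ENNReal.ofReal_eq_one, Real.exp_eq_one_iff, neg_eq_zero,
      ENNReal.toReal_eq_zero_iff] at h1
    exact h1.resolve_right (hfin x)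
  · have : NeBot (ae μ) := ae_neBot.2 hμ
    obtain ⟨x, hx⟩ := (Measure.ae_ae_of_ae_prod h).exists
    have h0 : P {ω | ω.count (Prod.mk x ⁻¹' A) = 0} = 0 := by
      rw [measure_eq_zero_iff_ae_notMem]
      filter_upwards [hx, hslice x] with ω h1 h2 using fun h => h1 (h2.2 h)
    rw [hval x, ENNReal.ofReal_eq_zero] at h0
    exact absurd h0 (Real.exp_pos _).not_ge

end Ergodic

theorem mainTheorem5 {𝕜 : Type*} [RCLike 𝕜]
    {X : Type*} [MeasurableSpace X] [StandardBorelSpace X]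
    (μ : Measure X) [SigmaFinite μ] [NullSingletonClass μ] (hμ : μ Set.univ = ⊤)
    {G : Type*} [Group G] [MulAction G X] [MeasurableConstSMul G X] [SMulInvariantMeasure G X μ]
    (P : Measure (CountableSubset X)) (hP : IsPoissonPointProcess μ P)
    (hErg : ErgodicSMul G (X × CountableSubset X) (μ.prod P))
    (Φ : X → Lp 𝕜 1 μ) (hΦ : Measurable[_, borel (Lp 𝕜 1 μ)] Φ)
    (hequiv : ∀ g : G, ∀ᵐ x ∂μ, (fun y => Φ (g • x) (g • y)) =ᵐ[μ] Φ x) :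
    ∀ᵐ x ∂μ, Φ x = 0 := by
  have hμ0 : μ ≠ 0 := by
    rintro rfl
    simp at hμ
  have : Fact ((1 : ℝ≥0∞) ≠ ⊤) := ⟨ENNReal.one_ne_top⟩
  obtain ⟨f, hf, hfΦ⟩ := exists_measurable_enorm_version hΦ
  have hlevel : ∀ n : ℕ, ∀ᵐ x ∂μ, μ {y | ((n : ℝ≥0∞) + 1)⁻¹ ≤ f (x, y)} = 0 := fun n => by
    refine ae_measure_section_eq_zero (G := G) hμ0 hP (A := {p | ((n : ℝ≥0∞) + 1)⁻¹ ≤ f p})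
      (measurableSet_le measurable_const hf) (fun x => ?_) fun g => ?_
    · have hint : ∫⁻ y, f (x, y) ∂μ ≠ ⊤ := by
        rw [lintegral_congr_ae (hfΦ x)]
        exact (L1.integrable_coeFn (Φ x)).2.ne
      -- Markov's inequality.
      exact ne_top_of_le_ne_top (ENNReal.div_ne_top hint (by simp))
        (meas_ge_le_lintegral_div (hf.comp measurable_prodMk_left).aemeasurable (by simp) (by simp))
    · filter_upwards [hequiv g] with x hx
      filter_upwards [hx, hfΦ x,
        (measurePreserving_smul g μ).quasiMeasurePreserving.ae (hfΦ (g • x))] with y h1 h2 h3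
      rw [h2, h3, h1]
  filter_upwards [ae_all_iff.2 hlevel] with x hx
  rw [Lp.eq_zero_iff_ae_eq_zero]
  filter_upwards [hfΦ x, ae_all_iff.2 fun n => measure_eq_zero_iff_ae_notMem.1 (hx n)] with y h1 h2
  by_contra hne
  obtain ⟨n, hn⟩ := ENNReal.exists_inv_nat_lt (enorm_ne_zero.2 hne)
  refine h2 n ?_
  rw [h1]
  exact (ENNReal.inv_le_inv.2 le_self_add).trans hn.le
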